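/- For integers $N\ge 1$ and $k\ge 0$, let $$H(N,k)=\sum_{1\le i_1<\cdots<i_k\le N}\frac{1}{i_1\cdots i_k}\qquad(H(N,0)=1)$$ be the $k$-th elementary symmetric function of $1,\tfrac12,\dots,\tfrac1N$, and let $v_3$ denote the $3$-adic valuation on $\mathbb{Q}$. Let $a\in\{1,2\}$. Then for all positive integers $n$ and $k$ such that $n\ge 3$, $k\le a3^n$ and $2\mid (k-a)$, we have $$v_3\big(H(a3^n,k)\big)\le -n .$$ -/

import Mathlib

/-- The `k`-th elementary symmetric function `H(n, k)` of `1, 1/2, …, 1/n`: the sum of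
`1 / (i₁ ⋯ iₖ)` over all `1 ≤ i₁ < ⋯ < iₖ ≤ n`, that is, over all `k`-element subsets of
`{1, …, n}`. In particular `H(n, 0) = 1`. -/
def harmonicESymm (n k : ℕ) : ℚ :=
  ∑ s ∈ (Finset.Icc 1 n).powersetCard k, 1 / ∏ i ∈ s, (i : ℚ)

/-! Write $F_N=\prod_{i\le N}(X+i)$, so $H(N,k)$ is the $X^k$-coefficient of $F_N$ over $N!$. Choose
$m$ with $a3^m\le k\le a3^{m+1}$ and put $n=m+1+d$. Splitting off the multiples of 3 repeatedly
gives $F_{a3^n}(3^dX)=3^eF_{a3^{m+1}}(X)(w+3^{m+1}T)$ with $3\nmid w$ (`exists_shiftProd_comp_eq`).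
Modulo $3^{m+1}$, $F_{a3^{m+1}}\equiv(X^3-X)^{a3^m}$, whose $k$-th coefficient is $\pm$ a binomial
coefficient of valuation at most $m$ (`not_three_pow_dvd_coeff`). Comparing coefficients $k$ and $0$
yields $v_3(H)\le m-v_3((a3^{m+1})!)-dk$, and Legendre's formula finishes. -/

open Polynomial in
/-- The product `g(X) g(X + 1) ⋯ g(X + N - 1)`. -/
noncomputable def shiftProd (g : ℤ[X]) (N : ℕ) : ℤ[X] :=
  ∏ i ∈ Finset.range N, g.comp (X + C (i : ℤ))

section ShiftProd

open Polynomial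

/-! ### Congruences for shifted products modulo powers of 3 -/

theorem shiftProd_add (g : ℤ[X]) (N M : ℕ) :
    shiftProd g (N + M) = shiftProd g N * (shiftProd g M).comp (X + C (N : ℤ)) := by
  simp only [shiftProd, Finset.prod_range_add, Polynomial.prod_comp, comp_assoc]
  congr 1
  refine Finset.prod_congr rfl fun i _ => ?_
  congr 1
  simp
  ring

theorem exists_comp_X_add_C (P : ℤ[X]) (q : ℤ) :
    ∃ D : ℤ[X], P.comp (X + C q) = P + C q * D := by
  obtain ⟨D, hD⟩ := sub_dvd_eval_sub (X + C q) X (P.map C)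
  refine ⟨D, ?_⟩
  rw [eval_map, eval_map, eval₂_C_X] at hD
  change P.comp (X + C q) - P = _ at hD
  rw [add_sub_cancel_left] at hD
  rw [← hD]
  ring

/-- Expand $P(X)P(X+q)P(X+2q)$ to second order in $q=N$: the linear terms add up to $3qP^2D$, and
the rest is divisible by $q^2$, hence by $3q$ as $3\mid q$. -/
theorem shiftProd_three_mul_modEq (g : ℤ[X]) (N : ℕ) (hN : 3 ∣ N) :
    C ((3 * N : ℕ) : ℤ) ∣ shiftProd g (3 * N) - shiftProd g N ^ 3 := by
  obtain ⟨D, hD⟩ := exists_comp_X_add_C (shiftProd g N) N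
  obtain ⟨E, hE⟩ := exists_comp_X_add_C D N
  obtain ⟨t, rfl⟩ := hN
  set q := 3 * t with hq
  have h2 : ((shiftProd g q).comp (X + C (q : ℤ))).comp (X + C (q : ℤ))
      = shiftProd g q + 2 * C (q : ℤ) * D + C (q : ℤ) ^ 2 * E := by
    rw [hD, add_comp, mul_comp, C_comp, hD, hE]
    ring
  have h3 : shiftProd g (3 * q) = shiftProd g q * (shiftProd g q + C (q : ℤ) * D) *
      (shiftProd g q + 2 * C (q : ℤ) * D + C (q : ℤ) ^ 2 * E) := by
    rw [show 3 * q = q + (q + q) by ring, shiftProd_add, shiftProd_add, mul_comp, h2, hD]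
    ring
  have hc : C (q : ℤ) = 3 * C (t : ℤ) := by
    rw [hq]; push_cast; simp
  have hc' : C ((3 * q : ℕ) : ℤ) = 3 * C (q : ℤ) := by
    push_cast; simp
  rw [h3, hc']
  set P := shiftProd g q
  refine ⟨P ^ 2 * D + C (t : ℤ) * (P ^ 2 * E + 2 * P * D ^ 2 + C (q : ℤ) * P * D * E), ?_⟩
  rw [hc]
  ring

theorem three_mul_dvd_cube_sub_cube {P Q : ℤ[X]} {r : ℕ}
    (h : C ((3 : ℤ) ^ (r + 1)) ∣ P - Q) : C ((3 : ℤ) ^ (r + 2)) ∣ P ^ 3 - Q ^ 3 := by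
  obtain ⟨T, hT⟩ := h
  have hP : P = Q + 3 * C ((3 : ℤ) ^ r) * T := by
    rw [pow_succ, C_mul] at hT
    have : (C (3 : ℤ)) = (3 : ℤ[X]) := rfl
    rw [this] at hT
    linear_combination hT
  have hC : C ((3 : ℤ) ^ (r + 2)) = 9 * C ((3 : ℤ) ^ r) := by
    rw [pow_add, C_mul, mul_comm]; norm_num
  rw [hP, hC]
  set c := C ((3 : ℤ) ^ r)
  exact ⟨Q ^ 2 * T + 3 * Q * c * T ^ 2 + 3 * c ^ 2 * T ^ 3, by ring⟩

theorem shiftProd_three_pow_modEq {g A : ℤ[X]} (h : C (3 : ℤ) ∣ shiftProd g 3 - A) (r : ℕ) :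
    C ((3 : ℤ) ^ (r + 1)) ∣ shiftProd g (3 ^ (r + 1)) - A ^ 3 ^ r := by
  induction r with
  | zero => simpa using h
  | succ r ih =>
    have h1 := shiftProd_three_mul_modEq g (3 ^ (r + 1)) (dvd_pow_self 3 (by omega))
    have h2 := three_mul_dvd_cube_sub_cube ih
    have e : 3 * 3 ^ (r + 1) = 3 ^ (r + 2) := by ring
    rw [e] at h1
    push_cast at h1
    have := dvd_add h1 h2
    rw [sub_add_sub_cancel, ← pow_mul, ← pow_succ] at this
    exact this

theorem shiftProd_mul_modEq (g : ℤ[X]) (a N : ℕ) :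
    C (N : ℤ) ∣ shiftProd g (a * N) - shiftProd g N ^ a := by
  induction a with
  | zero => simp [shiftProd]
  | succ a ih =>
    obtain ⟨T, hT⟩ := ih
    obtain ⟨D, hD⟩ := exists_comp_X_add_C (shiftProd g N) ((a * N : ℕ) : ℤ)
    rw [add_mul, one_mul, shiftProd_add, hD, sub_eq_iff_eq_add.1 hT]
    push_cast
    rw [C_mul]
    exact ⟨shiftProd g N * T + (C (N : ℤ) * T + shiftProd g N ^ a) * C (a : ℤ) * D, by ring⟩

theorem shiftProd_mul_three_pow_modEq {g A : ℤ[X]} (h : C (3 : ℤ) ∣ shiftProd g 3 - A)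
    (a r : ℕ) :
    C ((3 : ℤ) ^ (r + 1)) ∣ shiftProd g (a * 3 ^ (r + 1)) - A ^ (a * 3 ^ r) := by
  have h1 := shiftProd_mul_modEq g a (3 ^ (r + 1))
  have h2 := (shiftProd_three_pow_modEq h r).trans
    (sub_dvd_pow_sub_pow (shiftProd g (3 ^ (r + 1))) (A ^ 3 ^ r) a)
  push_cast at h1
  have := dvd_add h1 h2
  rwa [sub_add_sub_cancel, ← pow_mul, mul_comm (3 ^ r)] at this

theorem shiftProd_X_add_one_modEq (a r : ℕ) :
    C ((3 : ℤ) ^ (r + 1)) ∣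
      shiftProd (X + 1) (a * 3 ^ (r + 1)) - (X ^ 3 - X) ^ (a * 3 ^ r) := by
  refine shiftProd_mul_three_pow_modEq ⟨2 * X ^ 2 + 4 * X + 2, ?_⟩ a r
  simp [shiftProd, Finset.prod_range_succ]
  ring

theorem shiftProd_units_modEq (a r : ℕ) :
    C ((3 : ℤ) ^ (r + 1)) ∣
      shiftProd ((3 * X + 1) * (3 * X + 2)) (a * 3 ^ (r + 1)) - C (2 ^ (a * 3 ^ r)) := by
  have h : C (3 : ℤ) ∣ shiftProd ((3 * X + 1) * (3 * X + 2)) 3 - C 2 := by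
    -- Each factor is $2+3y_i$ with $y_i=3(X+i)(X+i+1)$; the witness is $(\prod(2+3y_i)-2)/3$.
    refine ⟨9 * (3 * X * (X + 1)) * (3 * (X + 1) * (X + 2)) * (3 * (X + 2) * (X + 3))
      + 6 * ((3 * X * (X + 1)) * (3 * (X + 1) * (X + 2))
        + (3 * X * (X + 1)) * (3 * (X + 2) * (X + 3))
        + (3 * (X + 1) * (X + 2)) * (3 * (X + 2) * (X + 3)))
      + 4 * (3 * X * (X + 1) + 3 * (X + 1) * (X + 2) + 3 * (X + 2) * (X + 3)) + 2, ?_⟩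
    simp [shiftProd, Finset.prod_range_succ]
    ring
  simpa using shiftProd_mul_three_pow_modEq h a r

/-! ### Rescaling the variable by powers of 3 -/

/-- The factors $3X+i$ with $3\mid i$ each release a 3 and rebuild the shorter product; the others
pair up as $(3X+1)(3X+2)$ and its shifts. -/
theorem shiftProd_three_mul_comp (M : ℕ) :
    (shiftProd (X + 1) (3 * M)).comp (C 3 * X) =
      C (3 ^ M) * shiftProd (X + 1) M * shiftProd ((3 * X + 1) * (3 * X + 2)) M := by
  induction M with
  | zero => simp [shiftProd]
  | succ M ih =>
    have e : 3 * (M + 1) = 3 * M + 3 := by ring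
    simp only [e, shiftProd_add _ (3 * M) 3, shiftProd_add _ M 1, mul_comp, ih]
    simp [shiftProd, Finset.prod_range_succ, pow_succ]
    ring

theorem exists_shiftProd_comp_eq (a m d : ℕ) :
    ∃ (e : ℕ) (w : ℤ) (T : ℤ[X]), ¬ 3 ∣ w ∧
      (shiftProd (X + 1) (a * 3 ^ (m + 1 + d))).comp (C (3 ^ d) * X) =
        C (3 ^ e) * shiftProd (X + 1) (a * 3 ^ (m + 1)) * (C w + C (3 ^ (m + 1)) * T) := by
  induction d with
  | zero => exact ⟨0, 1, 0, by norm_num, by simp⟩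
  | succ d ih =>
    obtain ⟨e, w, T, hw, h⟩ := ih
    obtain ⟨S, hS⟩ := shiftProd_units_modEq a (m + d)
    have e1 : a * 3 ^ (m + 1 + (d + 1)) = 3 * (a * 3 ^ (m + 1 + d)) := by ring
    have e2 : (C (3 ^ (d + 1)) * X : ℤ[X]) = (C 3 * X : ℤ[X]).comp (C (3 ^ d) * X) := by
      simp [pow_succ]; ring
    have e3 : m + d + 1 = m + 1 + d := by ring
    rw [e3, sub_eq_iff_eq_add] at hS
    refine ⟨a * 3 ^ (m + 1 + d) + e, 2 ^ (a * 3 ^ (m + d)) * w,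
      C (3 ^ d) * S.comp (C (3 ^ d) * X) * (C w + C (3 ^ (m + 1)) * T)
        + C (2 ^ (a * 3 ^ (m + d))) * T, ?_, ?_⟩
    · intro h3
      rcases Int.prime_three.dvd_or_dvd h3 with h3 | h3
      · have := Int.prime_three.dvd_of_dvd_pow h3
        omega
      · exact hw h3
    · rw [e1, e2, ← comp_assoc, shiftProd_three_mul_comp, mul_comp, mul_comp, C_comp, h, hS,
        add_comp, mul_comp, C_comp, C_comp]
      simp only [pow_add _ (m + 1) d, pow_add _ _ e, C_mul]
      ring

/-! ### Coefficients, harmonic sums and valuations -/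

theorem shiftProd_coeff_zero (N : ℕ) : (shiftProd (X + 1) N).coeff 0 = (N.factorial : ℤ) := by
  rw [coeff_zero_eq_eval_zero, shiftProd, eval_prod, ← Finset.prod_range_add_one_eq_factorial]
  push_cast
  refine Finset.prod_congr rfl fun i _ => ?_
  simp

theorem shiftProd_eq_prod_Icc (N : ℕ) :
    shiftProd (X + 1) N = ∏ i ∈ Finset.Icc 1 N, (X + C (i : ℤ)) := by
  rw [shiftProd, Finset.range_eq_Ico, ← Finset.Ico_add_one_right_eq_Icc,
    ← Finset.prod_Ico_add' _ 0 N 1]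
  refine Finset.prod_congr rfl fun i _ => ?_
  simp
  ring

theorem harmonicESymm_eq_coeff_div {N k : ℕ} (hk : k ≤ N) :
    harmonicESymm N k = ((shiftProd (X + 1) N).coeff k : ℚ) / (N.factorial : ℚ) := by
  rw [shiftProd_eq_prod_Icc, Finset.prod_X_add_C_coeff _ _ (by simpa using hk), harmonicESymm,
    Nat.card_Icc, Nat.add_sub_cancel]
  push_cast
  rw [Finset.sum_div]
  have hne : ∀ t : Finset ℕ, t ⊆ Finset.Icc 1 N → ∏ i ∈ t, (i : ℚ) ≠ 0 := fun t ht =>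
    Finset.prod_ne_zero_iff.2 fun i hi => by
      have := (Finset.mem_Icc.1 (ht hi)).1
      positivity
  refine Finset.sum_nbij' (fun s => Finset.Icc 1 N \ s) (fun s => Finset.Icc 1 N \ s)
    ?_ ?_ ?_ ?_ ?_
  · intro s hs
    rw [Finset.mem_powersetCard] at hs ⊢
    exact ⟨Finset.sdiff_subset, by rw [Finset.card_sdiff_of_subset hs.1, hs.2]; simp⟩
  · intro s hs
    rw [Finset.mem_powersetCard] at hs ⊢
    refine ⟨Finset.sdiff_subset, ?_⟩
    rw [Finset.card_sdiff_of_subset hs.1, hs.2]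
    simp
    omega
  · intro s hs
    exact Finset.sdiff_sdiff_eq_self (Finset.mem_powersetCard.1 hs).1
  · intro s hs
    exact Finset.sdiff_sdiff_eq_self (Finset.mem_powersetCard.1 hs).1
  · intro s hs
    have hs := (Finset.mem_powersetCard.1 hs).1
    have hf : (N.factorial : ℚ) = ∏ i ∈ Finset.Icc 1 N, (i : ℚ) := by
      rw [← Finset.prod_Ico_id_eq_factorial, Finset.Ico_add_one_right_eq_Icc]; push_cast; rfl
    rw [hf, ← Finset.prod_sdiff hs, div_eq_div_iff (hne _ hs)
      (mul_ne_zero (hne _ Finset.sdiff_subset) (hne _ hs))]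
    ring

theorem coeff_X_pow_three_sub_X_pow (M j : ℕ) :
    ((X ^ 3 - X : ℤ[X]) ^ M).coeff (M + 2 * j) = (-1) ^ (M - j) * (M.choose j : ℤ) := by
  have h : (X ^ 3 - X : ℤ[X]) ^ M = X ^ M * expand ℤ 2 ((X + C (-1)) ^ M) := by
    rw [map_pow, ← mul_pow]
    simp
    ring
  rw [h, add_comm M, coeff_X_pow_mul, mul_comm 2, coeff_expand_mul (by norm_num),
    coeff_X_add_C_pow]

theorem not_three_pow_dvd_coeff {a m k : ℕ} (ha : a = 1 ∨ a = 2)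
    (hk1 : a * 3 ^ m ≤ k) (hk2 : k ≤ a * 3 ^ (m + 1)) (hpar : (2 : ℤ) ∣ (k : ℤ) - (a : ℤ)) :
    ¬ (3 : ℤ) ^ (m + 1) ∣ (shiftProd (X + 1) (a * 3 ^ (m + 1))).coeff k := by
  intro hd
  have h1 := C_dvd_iff_dvd_coeff _ _ |>.1 (shiftProd_X_add_one_modEq a m) k
  rw [coeff_sub, dvd_sub_right hd] at h1
  set M := a * 3 ^ m with hM
  -- As $3^m$ is odd, $M$ has the parity of $a$, so $k-M$ is even.
  have hodd : Odd (3 ^ m) := Odd.pow (by decide)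
  obtain ⟨t, ht⟩ := hodd
  have hMa : M = 2 * (a * t) + a := by rw [hM, ht]; ring
  have hM3 : a * 3 ^ (m + 1) = 3 * M := by rw [hM]; ring
  obtain ⟨j, hj⟩ : ∃ j, k = M + 2 * j := ⟨(k - M) / 2, by omega⟩
  have hjM : j ≤ M := by omega
  rw [hj, coeff_X_pow_three_sub_X_pow] at h1
  have h2 : (3 : ℤ) ^ (m + 1) ∣ (M.choose j : ℤ) := by
    rcases neg_one_pow_eq_or ℤ (M - j) with h | h <;> simpa [h] using h1
  have h3 : 3 ^ (m + 1) ∣ M.choose j := by exact_mod_cast h2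
  have h4 := (Nat.prime_three.pow_dvd_iff_le_factorization (Nat.choose_pos hjM).ne').1 h3
  have h5 : (M.choose j).factorization 3 ≤ Nat.log 3 M := Nat.factorization_choose_le_log
  -- Here $a<3$ matters: it forces $M<3^{m+1}$.
  have h6 : Nat.log 3 M < m + 1 := by
    refine Nat.log_lt_of_lt_pow (by rcases ha with rfl | rfl <;> positivity) ?_
    rw [hM, pow_succ]
    have : 0 < 3 ^ m := by positivity
    rcases ha with rfl | rfl <;> omega
  omega

end ShiftProd

theorem two_mul_add_one_le_padicValNat_factorial {a : ℕ} (ha : 1 ≤ a) (m : ℕ) :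
    2 * m + 1 ≤ padicValNat 3 (a * 3 ^ (m + 1)).factorial := by
  have : Fact (Nat.Prime 3) := ⟨Nat.prime_three⟩
  induction m with
  | zero =>
    rw [zero_add, pow_one, mul_comm a, padicValNat_factorial_mul]
    omega
  | succ m ih =>
    rw [show a * 3 ^ (m + 1 + 1) = 3 * (a * 3 ^ (m + 1)) by ring, padicValNat_factorial_mul]
    have : 1 ≤ a * 3 ^ m := Nat.mul_pos ha (by positivity)
    have : a * 3 ^ (m + 1) = 3 * (a * 3 ^ m) := by ring
    omega

theorem exists_mul_three_pow_le {a n k : ℕ} (hn : 1 ≤ n) (hak : a ≤ k)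
    (hkn : k ≤ a * 3 ^ n) :
    ∃ m d, n = m + 1 + d ∧ a * 3 ^ m ≤ k ∧ k ≤ a * 3 ^ (m + 1) := by
  induction n, hn using Nat.le_induction with
  | base => exact ⟨0, 0, rfl, by simpa using hak, by simpa using hkn⟩
  | succ n hn ih =>
    rcases le_total k (a * 3 ^ n) with h | h
    · obtain ⟨m, d, h1, h2, h3⟩ := ih h
      exact ⟨m, d + 1, by omega, h2, h3⟩
    · exact ⟨n, 0, rfl, h, hkn⟩

-- The constant term carries the same factor $3^e$ as the $k$-th coefficient, so $e$ cancels in the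
-- quotient and only $3^{dk}$ from the rescaling survives.
open Polynomial in
theorem padicValRat_harmonicESymm_le {a m d k : ℕ} (ha : a = 1 ∨ a = 2)
    (hk1 : a * 3 ^ m ≤ k) (hk2 : k ≤ a * 3 ^ (m + 1)) (hpar : (2 : ℤ) ∣ (k : ℤ) - (a : ℤ)) :
    padicValRat 3 (harmonicESymm (a * 3 ^ (m + 1 + d)) k) ≤
      m - padicValNat 3 (a * 3 ^ (m + 1)).factorial - d * k := by
  have : Fact (Nat.Prime 3) := ⟨Nat.prime_three⟩
  obtain ⟨e, w, T, hw, h⟩ := exists_shiftProd_comp_eq a m d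
  have hkN : k ≤ a * 3 ^ (m + 1 + d) :=
    hk2.trans (Nat.mul_le_mul_left a (Nat.pow_le_pow_right (by norm_num) (by omega)))
  rw [harmonicESymm_eq_coeff_div hkN]
  set F := shiftProd (X + 1) (a * 3 ^ (m + 1)) with hF
  have h0 := congrArg (fun p => coeff p 0) h
  have hk := congrArg (fun p => coeff p k) h
  simp only [comp_C_mul_X_coeff, mul_assoc, coeff_C_mul, mul_coeff_zero, coeff_add, coeff_C_zero,
    pow_zero, mul_one] at h0 hk
  rw [shiftProd_coeff_zero, hF, shiftProd_coeff_zero] at h0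
  set B := (F * (C w + C (3 ^ (m + 1)) * T)).coeff k with hB
  set u := w + 3 ^ (m + 1) * T.coeff 0 with hu
  have hu3 : ¬ (3 : ℤ) ∣ u := by
    rw [hu, pow_succ]
    intro h
    apply hw
    have : (3 : ℤ) ∣ 3 ^ m * 3 * T.coeff 0 := ⟨3 ^ m * T.coeff 0, by ring⟩
    exact (dvd_add_left this).1 h
  have hB3 : ¬ (3 : ℤ) ^ (m + 1) ∣ B := by
    have e1 : B = w * F.coeff k + 3 ^ (m + 1) * (F * T).coeff k := by
      rw [hB, mul_add, mul_left_comm, coeff_add, mul_comm F, coeff_C_mul, coeff_C_mul]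
    rw [e1]
    intro h
    have h1 := (dvd_add_left (dvd_mul_right _ _)).1 h
    have hcop : IsCoprime ((3 : ℤ) ^ (m + 1)) w :=
      ((Int.prime_three.coprime_iff_not_dvd).2 hw).pow_left
    exact not_three_pow_dvd_coeff ha hk1 hk2 hpar (hcop.dvd_of_dvd_mul_left h1)
  have hB0 : B ≠ 0 := fun h => hB3 (h ▸ dvd_zero _)
  have hu0 : u ≠ 0 := fun h => hu3 (h ▸ dvd_zero _)
  have hvB : padicValInt 3 B ≤ m := by
    by_contra! hlt
    exact hB3 ((padicValInt_dvd_iff (p := 3) (m + 1) B).2 (Or.inr hlt))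
  have hvu : padicValInt 3 u = 0 := padicValInt.eq_zero_of_not_dvd hu3
  set c := (shiftProd (X + 1) (a * 3 ^ (m + 1 + d))).coeff k
  have hc0 : c ≠ 0 := by
    rintro h
    rw [h, zero_mul, eq_comm, mul_eq_zero] at hk
    rcases hk with h | h
    · exact absurd h (by positivity)
    · exact hB0 h
  have hk' := congrArg (fun z : ℤ => padicValRat 3 (z : ℚ)) hk
  have h0' := congrArg (fun z : ℤ => padicValRat 3 (z : ℚ)) h0
  have hcq : (c : ℚ) ≠ 0 := by exact_mod_cast hc0
  have hBq : (B : ℚ) ≠ 0 := by exact_mod_cast hB0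
  have huq : (u : ℚ) ≠ 0 := by exact_mod_cast hu0
  have hN1 : ((a * 3 ^ (m + 1 + d)).factorial : ℚ) ≠ 0 := by positivity
  have hN2 : ((a * 3 ^ (m + 1)).factorial : ℚ) ≠ 0 := by positivity
  have hpow (i : ℕ) : padicValRat 3 ((3 : ℚ) ^ i) = i := by
    have h := padicValRat.self_pow_inv (p := 3) i
    rw [padicValRat.inv] at h
    exact_mod_cast neg_inj.1 h
  simp only [Int.cast_mul, Int.cast_pow, Int.cast_natCast, Int.cast_ofNat] at hk' h0'
  rw [padicValRat.mul hcq (by positivity), padicValRat.mul (by positivity) hBq,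
    ← pow_mul, hpow, hpow] at hk'
  rw [padicValRat.mul (by positivity) (mul_ne_zero hN2 huq), padicValRat.mul hN2 huq,
    hpow, padicValRat.of_int, hvu] at h0'
  rw [padicValRat.div hcq hN1, h0', padicValRat.of_nat]
  push_cast at hk' ⊢
  have : padicValRat 3 B ≤ m := by
    rw [padicValRat.of_int]
    exact_mod_cast hvB
  linarith

theorem corollary1p6 (a n k : ℕ) (ha : a = 1 ∨ a = 2) (hn : 3 ≤ n) (hk : 1 ≤ k)
    (hkn : k ≤ a * 3 ^ n) (hpar : (2 : ℤ) ∣ (k : ℤ) - (a : ℤ)) :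
    padicValRat 3 (harmonicESymm (a * 3 ^ n) k) ≤ -(n : ℤ) := by
  obtain ⟨m, d, rfl, h1, h2⟩ := exists_mul_three_pow_le (by omega) (by omega : a ≤ k) hkn
  have h3 := padicValRat_harmonicESymm_le (d := d) ha h1 h2 hpar
  have h4 := two_mul_add_one_le_padicValNat_factorial (a := a) (by omega) m
  have h5 : d ≤ d * k := Nat.le_mul_of_pos_right d hk
  have h4 := (Nat.cast_le (α := ℤ)).2 h4
  have h5 := (Nat.cast_le (α := ℤ)).2 h5
  simp only [Nat.cast_add, Nat.cast_mul, Nat.cast_ofNat, Nat.cast_one] at h4 h5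
  push_cast
  -- The bounds combine to $m-(2m+1)-d=-(m+1+d)$.
  linarith
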